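/- Let $I=[a,b]$ with $a<b$, let $I\subset\Omega\subset\mathbb{R}$, and let $p:\Omega\to[1,\infty)$ be bounded and satisfy the strong $\log$-Hölder condition $$\lim_{x\to y}|p(x)-p(y)|\,\log\Big(e+\frac1{|x-y|}\Big)=0\qquad\text{uniformly in } y\in\Omega .$$ Put $\varphi(x,t):=t^{p(x)}$ for $t\ge 0$ and $\varphi^+_{A}(t):=\sup_{x\in A}\varphi(x,t)$, and for $f:I\to\mathbb{R}$ let $$\overline V^{\varphi}_I(f):=\limsup_{|(I_k)|\to0}\ \sum_{k=1}^n\varphi^+_{I_k}\Big(\frac{|f(b_k)-f(a_k)|}{|I_k|}\Big)|I_k| ,$$ where $(I_k)$ runs over the partitions of $I$ into finitely many non-degenerate closed intervals $I_k=[a_k,b_k]$ with disjoint interiors and $|(I_k)|:=\max_k|I_k|$. Let $f\in \mathrm{BV}(I)$ be left-continuous, i.e. $f:I\to\mathbb R$ has bounded variation on $I$ and is left-continuous at every point of $(a,b]$. Let $Df$ be the finite signed Borel measure on $I$ with $Df([a,x))=f(x)-f(a)$ for all $x\in I$ and $Df(\{b\})=0$ (so $Df(\{a\})=f(a+)-f(a)$),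 and let $Df=f'\,dx+D^sf$ be its Lebesgue decomposition with respect to the Lebesgue measure, with $|D^sf|$ the total variation of the singular part. 1. If $\overline V^{\varphi}_I(f)<\infty$, then $|D^sf|(\{x\in I: p(x)>1\})=0$. 2. If $|D^sf|(\{x\in I: p(x)>1\})=0$ (in particular, by 1, whenever $\overline V^{\varphi}_I(f)<\infty$), then, as an equality in $[0,\infty]$, $$\overline V^{\varphi}_I(f)=\int_I|f'|^{p(x)}\,dx+|D^sf|(\{x\in I: p(x)=1\}).$$ -/

import Mathlib

open MeasureTheory Filter Topology Set
open scoped NNReal ENNReal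

noncomputable section

namespace RieszVar

/-- A partition of `[a, b]` into finitely many non-degenerate closed intervals with disjoint
interiors: the intervals are `[t k, t (k + 1)]` for `k < n`, where
`a = t 0 < t 1 < ⋯ < t n = b`. -/
structure Partition (a b : ℝ) where
  n : ℕ
  t : Fin (n + 1) → ℝ
  strictMono : StrictMono t
  first : t 0 = a
  last : t (Fin.last n) = b

namespace Partition

variable {a b : ℝ}

/-- The length of the `k`-th interval. -/
def len (P : Partition a b) (k : Fin P.n) : ℝ := P.t k.succ - P.t k.castSucc

/-- The `k`-th closed interval. -/
def interval (P : Partition a b) (k : Fin P.n) : Set ℝ := Icc (P.t k.castSucc) (P.t k.succ)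

/-- The length of the longest interval of the partition. -/
def mesh (P : Partition a b) : ℝ := ⨆ k : Fin P.n, P.len k

/-- The filter `|(I_k)| → 0` on the partitions of `[a, b]`. -/
def fine (a b : ℝ) : Filter (Partition a b) := comap mesh (𝓝 0)

end Partition

/-- `φ⁺_A(t) = sup_{x ∈ A} φ(x, t)`. -/
def phiPlus (φ : ℝ → ℝ≥0 → ℝ≥0∞) (A : Set ℝ) (t : ℝ≥0) : ℝ≥0∞ := ⨆ x ∈ A, φ x t

/-- The Riesz sum `∑ₖ φ⁺_{I_k}(|Δₖ f| / |I_k|) |I_k|` of `f` over a partition. -/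
def rieszSum (φ : ℝ → ℝ≥0 → ℝ≥0∞) (f : ℝ → ℝ) {a b : ℝ} (P : Partition a b) : ℝ≥0∞ :=
  ∑ k : Fin P.n,
    phiPlus φ (P.interval k) ‖(f (P.t k.succ) - f (P.t k.castSucc)) / P.len k‖₊ *
      ENNReal.ofReal (P.len k)

/-- The limsup variant of the Riesz `φ`-variation on `[a, b]`: the upper limit of the Riesz sums
as the length of the longest interval tends to zero. -/
def upperVariation (φ : ℝ → ℝ≥0 → ℝ≥0∞) (a b : ℝ) (f : ℝ → ℝ) : ℝ≥0∞ :=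
  limsup (fun P : Partition a b => rieszSum φ f P) (Partition.fine a b)

/-- The variable exponent function `φ(x, t) = t ^ p(x)`. -/
def varExp (p : ℝ → ℝ) (x : ℝ) (t : ℝ≥0) : ℝ≥0∞ := ((t ^ p x : ℝ≥0) : ℝ≥0∞)

/-- The strong log-Hölder condition: `|p(x) - p(y)| log(e + 1 / |x - y|) → 0` as `x → y`,
uniformly in `y ∈ Ω`. -/
def StrongLogHolder (p : ℝ → ℝ) (Ω : Set ℝ) : Prop :=
  ∀ ε > 0, ∃ δ > 0, ∀ y ∈ Ω, ∀ x ∈ Ω, x ≠ y → |x - y| < δ →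
    |p x - p y| * Real.log (Real.exp 1 + 1 / |x - y|) < ε

/-- The function equal to `f` on `[a, b]`, to `f a` to the left of `a` and to `f b` to the right
of `b` (for `a ≤ b`). -/
def clamp (a b : ℝ) (f : ℝ → ℝ) : ℝ → ℝ := fun x => f (max a (min b x))

theorem boundedVariationOn_clamp {a b : ℝ} {f : ℝ → ℝ} (hab : a ≤ b)
    (hf : BoundedVariationOn f (Icc a b)) : BoundedVariationOn (clamp a b f) univ := by
  refine ne_top_of_le_ne_top hf ?_
  refine eVariationOn.comp_le_of_monotoneOn f (fun x => max a (min b x)) ?_ ?_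
  · intro x _ y _ hxy
    exact max_le_max le_rfl (min_le_min le_rfl hxy)
  · intro x _
    exact ⟨le_max_left _ _, max_le hab (min_le_left _ _)⟩

section Derivative

variable {a b : ℝ} {f : ℝ → ℝ} (hab : a ≤ b) (hf : BoundedVariationOn f (Icc a b))

/-- The derivative measure `Df` of a function `f` of bounded variation on `[a, b]`: the
Lebesgue–Stieltjes signed measure of `f`, extended constantly outside of `[a, b]`. It is carried by
`[a, b]`, and satisfies `Df [a, x) = f x - f a` for `x ∈ [a, b]` when `f` is left-continuous;
in particular a jump of `f` at the left end-point `a` is an atom of `Df`. -/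
def D : SignedMeasure ℝ := (boundedVariationOn_clamp hab hf).vectorMeasure

/-- The total variation measure `|Dˢf|` of the singular part of `Df` in its Lebesgue decomposition
with respect to the Lebesgue measure. -/
def absDs : Measure ℝ := ((D hab hf).singularPart volume).totalVariation

/-- The function `f'` representing the absolutely continuous part `f' dx` of `Df`. -/
def density : ℝ → ℝ := (D hab hf).rnDeriv volume

end Derivative

end RieszVar

end

/-! Write `w = |Δf| / |I_k|` on an interval `I_k`, let `q` be the minimum of `p` there, and let `V ≥
1` bound all increments of `f`.

Upper bound. Since `w |I_k| ≤ V`, one has `log w ≤ log V + log (1 / |I_k|)`, so the strong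
log-Hölder condition gives `w ^ p(x) ≤ exp (ε (1 + log V)) w ^ q` on `I_k` once the mesh is small
(`rpow_le_exp_mul_rpow`). If `|Dˢf|` does not charge the cell, Jensen's inequality gives `w ^ q
|I_k| ≤ ∫ |f'| ^ q`; otherwise `q = 1`, because `|Dˢf|` vanishes on `{p > 1}`, and the increment is
at most `∫ |f'| + |Dˢf|`. Returning from `q` to `p(x)` costs at most `ε` per unit length
(`rpow_le_rpow_add_sub`).

Lower bound. Only continuity of `p` is needed. Up to `ε`, the mass of `|Dˢf|` on `{p = 1}` is
recovered from the increments over the intervals meeting a suitable Lebesgue-null compact `K ⊆ {p =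
1}` (`exists_isCompact_eventually_absDs_le`). The other intervals eventually cover almost every
point, so a.e. differentiability and Fatou's lemma yield `∫ |f'| ^ p` from them
(`lintegral_le_liminf`). The two families are disjoint, so the bounds add.

Part 1 uses such a `K` inside `{p ≥ 1 + r}`. There `t ^ p` is superlinear while the intervals
meeting `K` have vanishing total length, so a positive singular mass would force an infinite
variation. -/

namespace RieszVar

/-! ### Partitions, half-open cells and the filter of fine partitions -/

namespace Partition

variable {a b : ℝ} (P : Partition a b)

theorem castSucc_lt_succ (k : Fin P.n) : P.t k.castSucc < P.t k.succ :=
  P.strictMono k.castSucc_lt_succ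

theorem len_pos (k : Fin P.n) : 0 < P.len k := sub_pos.2 (P.castSucc_lt_succ k)

theorem len_le_mesh (k : Fin P.n) : P.len k ≤ P.mesh :=
  le_ciSup (f := fun k => P.len k) (finite_range _).bddAbove k

theorem t_mem_Icc (i : Fin (P.n + 1)) : P.t i ∈ Icc a b :=
  ⟨P.first.symm.le.trans (P.strictMono.monotone (Fin.zero_le i)),
    (P.strictMono.monotone (Fin.le_last i)).trans P.last.le⟩

theorem interval_subset (k : Fin P.n) : P.interval k ⊆ Icc a b :=
  Icc_subset_Icc (P.t_mem_Icc _).1 (P.t_mem_Icc _).2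

/-- The half-open version of the `k`-th interval. -/
def cell (k : Fin P.n) : Set ℝ := Ico (P.t k.castSucc) (P.t k.succ)

theorem cell_subset_interval (k : Fin P.n) : P.cell k ⊆ P.interval k := Ico_subset_Icc_self

theorem measurableSet_cell (k : Fin P.n) : MeasurableSet (P.cell k) := measurableSet_Ico

theorem volume_cell (k : Fin P.n) : volume (P.cell k) = ENNReal.ofReal (P.len k) :=
  Real.volume_Ico

theorem pairwise_disjoint_cell : Pairwise (Function.onFun Disjoint P.cell) := by
  have key : ∀ i j : Fin P.n, i < j → Disjoint (P.cell i) (P.cell j) := by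
    intro i j hij
    refine disjoint_left.2 fun x hx hx' => ?_
    have : P.t i.succ ≤ P.t j.castSucc :=
      P.strictMono.monotone (by
        rw [Fin.le_def, Fin.val_succ, Fin.val_castSucc]
        exact hij)
    exact absurd (hx.2.trans_le (this.trans hx'.1)) (lt_irrefl _)
  intro i j hij
  rcases hij.lt_or_gt with h | h
  · exact key i j h
  · exact (key j i h).symm

theorem iUnion_cell : ⋃ k, P.cell k = Ico a b := by
  refine subset_antisymm (iUnion_subset fun k => ?_) fun x hx => ?_
  · exact Ico_subset_Ico (P.t_mem_Icc _).1 (P.t_mem_Icc _).2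
  · by_contra hcon
    have key : ∀ i : Fin (P.n + 1), P.t i ≤ x := by
      intro i
      induction i using Fin.induction with
      | zero => exact P.first.le.trans hx.1
      | succ k ih =>
        by_contra h
        exact hcon (mem_iUnion.2 ⟨k, ih, not_le.1 h⟩)
    exact absurd ((P.last.symm.le.trans (key _)).trans_lt hx.2) (lt_irrefl _)

theorem sum_measure_cell (m : Measure ℝ) (S : Finset (Fin P.n)) :
    ∑ k ∈ S, m (P.cell k) = m (⋃ k ∈ S, P.cell k) :=
  (measure_biUnion_finset (fun _ _ _ _ h => P.pairwise_disjoint_cell h)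
    fun k _ => P.measurableSet_cell k).symm

theorem sum_measure_cell_univ (m : Measure ℝ) : ∑ k, m (P.cell k) = m (Ico a b) := by
  rw [sum_measure_cell, ← P.iUnion_cell]
  simp

theorem sum_lintegral_cell (m : Measure ℝ) (g : ℝ → ℝ≥0∞) :
    ∑ k, ∫⁻ x in P.cell k, g x ∂m = ∫⁻ x in Ico a b, g x ∂m := by
  rw [← P.iUnion_cell, lintegral_iUnion P.measurableSet_cell P.pairwise_disjoint_cell, tsum_fintype]

theorem abs_sub_le_len {k : Fin P.n} {x y : ℝ} (hx : x ∈ P.interval k) (hy : y ∈ P.interval k) :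
    |x - y| ≤ P.len k := by
  have h1 := hx.1
  have h2 := hx.2
  have h3 := hy.1
  have h4 := hy.2
  rw [abs_le, len]
  constructor <;> linarith

theorem eventually_len_lt {δ : ℝ} (hδ : 0 < δ) : ∀ᶠ P in fine a b, ∀ k, P.len k < δ := by
  have : ∀ᶠ P : Partition a b in fine a b, P.mesh < δ :=
    (eventually_lt_nhds hδ).comap mesh
  filter_upwards [this] with P hP k
  exact (P.len_le_mesh k).trans_lt hP

/-- The partition of `[a, b]` into `n + 1` intervals of equal length. -/
noncomputable def uniform (hab : a < b) (n : ℕ) : Partition a b where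
  n := n + 1
  t i := a + (b - a) * (i / (n + 1))
  strictMono i j hij := by
    have : (0 : ℝ) < b - a := sub_pos.2 hab
    have : ((i : ℕ) : ℝ) < (j : ℕ) := by exact_mod_cast hij
    dsimp only
    gcongr
  first := by simp
  last := by
    have : (n : ℝ) + 1 ≠ 0 := by positivity
    simp [div_self this]

theorem mesh_uniform (hab : a < b) (n : ℕ) :
    (uniform hab n).mesh = (b - a) * (1 / ((n : ℝ) + 1)) := by
  have h : ∀ k, (uniform hab n).len k = (b - a) * (1 / ((n : ℝ) + 1)) := by
    intro k
    have h1 : ((k.succ : ℕ) : ℝ) = (k.castSucc : ℕ) + 1 := by simp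
    change a + (b - a) * ((k.succ : ℕ) / ((n : ℝ) + 1)) -
      (a + (b - a) * ((k.castSucc : ℕ) / ((n : ℝ) + 1))) = _
    rw [h1]
    ring
  have : Nonempty (Fin (uniform hab n).n) := ⟨(0 : Fin (n + 1))⟩
  simp only [mesh, h, ciSup_const]

theorem fine_neBot (hab : a < b) : (fine a b).NeBot := by
  have h : Tendsto (uniform hab) atTop (fine a b) := by
    rw [fine, tendsto_comap_iff]
    have := (tendsto_one_div_add_atTop_nhds_zero_nat (𝕜 := ℝ)).const_mul (b - a)
    rw [mul_zero] at this
    exact this.congr fun n => (mesh_uniform hab n).symm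
  exact h.neBot

/-- Fatou's lemma is applied along this filter, which requires countable generation. -/
instance : (fine a b).IsCountablyGenerated := by
  unfold fine; infer_instance

open scoped Classical in
/-- The indices of the intervals of the partition that meet `K`. -/
noncomputable def meeting (K : Set ℝ) : Finset (Fin P.n) := {k | (P.interval k ∩ K).Nonempty}

variable {P} in
theorem mem_meeting {K : Set ℝ} {k : Fin P.n} : k ∈ P.meeting K ↔ (P.interval k ∩ K).Nonempty := by
  simp [meeting]

theorem subset_iUnion_cell_meeting {K : Set ℝ} (hK : K ⊆ Ico a b) :
    K ⊆ ⋃ k ∈ P.meeting K, P.cell k := by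
  intro x hx
  obtain ⟨k, hk⟩ := mem_iUnion.1 (P.iUnion_cell.symm ▸ hK hx : x ∈ ⋃ k, P.cell k)
  exact mem_biUnion (mem_meeting.2 ⟨x, P.cell_subset_interval k hk, hx⟩) hk

/-- Cells meeting `K` lie in a small closed thickening of `K`, whose measure tends to `m K = 0` by
compactness. -/
theorem eventually_measure_meeting_le (m : Measure ℝ) [IsLocallyFiniteMeasure m] {K : Set ℝ}
    (hK : IsCompact K) (hm : m K = 0) {ε : ℝ≥0∞} (hε : ε ≠ 0) :
    ∀ᶠ P : Partition a b in fine a b, ∑ k ∈ P.meeting K, m (P.cell k) ≤ ε := by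
  have h := tendsto_measure_cthickening_of_isCompact (μ := m) hK
  rw [hm] at h
  have h1 := (h.eventually (eventually_le_nhds (pos_iff_ne_zero.2 hε)))
  obtain ⟨δ, hδ, h2⟩ := Metric.eventually_nhds_iff.1 h1
  filter_upwards [eventually_len_lt (half_pos hδ)] with P hP
  rw [sum_measure_cell]
  refine (measure_mono (iUnion₂_subset fun k hk => ?_)).trans
    (h2 (y := δ / 2) (by rw [Real.dist_eq, sub_zero, abs_of_pos (half_pos hδ)]; linarith))
  obtain ⟨y, hy, hyK⟩ := mem_meeting.1 hk
  intro x hx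
  refine Metric.mem_cthickening_of_dist_le x y _ _ hyK ?_
  rw [Real.dist_eq]
  exact (P.abs_sub_le_len (P.cell_subset_interval k hx) hy).trans (hP k).le

theorem eventually_disjoint_meeting {K L : Set ℝ} (hK : IsCompact K) (hL : IsCompact L)
    (h : Disjoint K L) :
    ∀ᶠ P : Partition a b in fine a b, Disjoint (P.meeting K) (P.meeting L) := by
  obtain ⟨r, hr, h2⟩ := Metric.exists_pos_forall_lt_edist hK hL.isClosed h
  filter_upwards [eventually_len_lt (NNReal.coe_pos.2 hr)] with P hP
  refine Finset.disjoint_left.2 fun k hk hk' => ?_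
  obtain ⟨x, hx, hxK⟩ := mem_meeting.1 hk
  obtain ⟨y, hy, hyL⟩ := mem_meeting.1 hk'
  have h3 := h2 x hxK y hyL
  have h4 := (P.abs_sub_le_len hx hy).trans_lt (hP k)
  rw [← Real.dist_eq] at h4
  rw [edist_nndist, ENNReal.coe_lt_coe, ← NNReal.coe_lt_coe, coe_nndist] at h3
  linarith

theorem meeting_union (K L : Set ℝ) : P.meeting (K ∪ L) = P.meeting K ∪ P.meeting L := by
  ext k
  simp [mem_meeting, inter_union_distrib_left, union_nonempty]

end Partition

/-! ### The measure `Df`: increments, Jordan and Lebesgue decompositions -/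

section Derivative

variable {a b : ℝ} {f : ℝ → ℝ} (hab : a ≤ b) (hf : BoundedVariationOn f (Icc a b))

theorem clamp_eq {x : ℝ} (hx : x ∈ Icc a b) : clamp a b f x = f x := by
  simp [clamp, min_eq_right hx.2, max_eq_right hx.1]

theorem leftLim_clamp (hab : a ≤ b)
    (hleft : ∀ x ∈ Ioc a b, ContinuousWithinAt f (Iic x) x) (x : ℝ) :
    Function.leftLim (clamp a b f) x = clamp a b f x := by
  refine ContinuousWithinAt.leftLim_eq ?_
  rcases le_or_gt x a with hxa | hxa
  · refine continuousWithinAt_const.congr (fun y hy => ?_) rfl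
    have : y ≤ a := (mem_Iic.1 hy).trans hxa
    simp [clamp, min_eq_right (this.trans hab), min_eq_right (hxa.trans hab), this, hxa]
  rcases le_or_gt x b with hxb | hxb
  · have h := hleft x ⟨hxa, hxb⟩
    refine h.congr_of_eventuallyEq ?_ (clamp_eq ⟨hxa.le, hxb⟩)
    have : ∀ᶠ y in 𝓝[≤] x, a < y := (eventually_gt_nhds hxa).filter_mono nhdsWithin_le_nhds
    filter_upwards [this, self_mem_nhdsWithin] with y hy hy'
    exact clamp_eq ⟨hy.le, (mem_Iic.1 hy').trans hxb⟩
  · have h : clamp a b f =ᶠ[𝓝 x] fun _ => f (max a b) := by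
      filter_upwards [eventually_gt_nhds hxb] with y hy
      simp [clamp, min_eq_left hy.le]
    exact (continuousAt_const.congr h.symm).continuousWithinAt

theorem D_Ico (hleft : ∀ x ∈ Ioc a b, ContinuousWithinAt f (Iic x) x) {s t : ℝ} (hst : s ≤ t)
    (hs : s ∈ Icc a b) (ht : t ∈ Icc a b) : D hab hf (Ico s t) = f t - f s := by
  rw [D, BoundedVariationOn.vectorMeasure_Ico _ hst, leftLim_clamp hab hleft,
    leftLim_clamp hab hleft, clamp_eq hs, clamp_eq ht]

theorem D_singleton_right (hleft : ∀ x ∈ Ioc a b, ContinuousWithinAt f (Iic x) x) :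
    D hab hf {b} = 0 := by
  rw [D, BoundedVariationOn.vectorMeasure_singleton, leftLim_clamp hab hleft, sub_eq_zero]
  refine ContinuousWithinAt.rightLim_eq ?_
  refine continuousWithinAt_const.congr (fun y hy => ?_) rfl
  simp [clamp, min_eq_left (mem_Ici.1 hy)]

/-- The positive part of the Jordan decomposition of `Df`. -/
noncomputable def posPart : Measure ℝ := (D hab hf).toJordanDecomposition.posPart

/-- The negative part of the Jordan decomposition of `Df`. -/
noncomputable def negPart : Measure ℝ := (D hab hf).toJordanDecomposition.negPart

instance : IsFiniteMeasure (posPart hab hf) := by unfold posPart; infer_instance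

instance : IsFiniteMeasure (negPart hab hf) := by unfold negPart; infer_instance

theorem mutuallySingular_posPart_negPart : posPart hab hf ⟂ₘ negPart hab hf :=
  (D hab hf).toJordanDecomposition.mutuallySingular

theorem absDs_eq : absDs hab hf =
    (posPart hab hf).singularPart volume + (negPart hab hf).singularPart volume :=
  SignedMeasure.singularPart_totalVariation _ _

theorem density_eq (x : ℝ) : density hab hf x =
    ((posPart hab hf).rnDeriv volume x).toReal - ((negPart hab hf).rnDeriv volume x).toReal := rfl

theorem measurable_density : Measurable (density hab hf) :=
  SignedMeasure.measurable_rnDeriv _ _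

instance : IsFiniteMeasure (absDs hab hf) := by unfold absDs; infer_instance

theorem integrable_density : Integrable (density hab hf) :=
  SignedMeasure.integrable_rnDeriv _ _

theorem sub_eq_posPart_sub_negPart (hleft : ∀ x ∈ Ioc a b, ContinuousWithinAt f (Iic x) x)
    {s t : ℝ} (hst : s ≤ t) (hs : s ∈ Icc a b) (ht : t ∈ Icc a b) :
    f t - f s = (posPart hab hf).real (Ico s t) - (negPart hab hf).real (Ico s t) := by
  rw [← D_Ico hab hf hleft hst hs ht,
    SignedMeasure.apply_eq_posPart_real_sub_negPart_real _ measurableSet_Ico]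
  rfl

/-- The Jordan parts agree on `{b}`, and by mutual singularity one of them vanishes there. Hence the
cells, which only cover `[a, b)`, lose no mass. -/
theorem posPart_add_negPart_singleton_right
    (hleft : ∀ x ∈ Ioc a b, ContinuousWithinAt f (Iic x) x) :
    posPart hab hf {b} = 0 ∧ negPart hab hf {b} = 0 := by
  have h := D_singleton_right hab hf hleft
  rw [SignedMeasure.apply_eq_posPart_real_sub_negPart_real _ (measurableSet_singleton b),
    sub_eq_zero] at h
  change (posPart hab hf).real {b} = (negPart hab hf).real {b} at h
  rw [measureReal_def, measureReal_def, ENNReal.toReal_eq_toReal_iff' (measure_ne_top _ _)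
    (measure_ne_top _ _)] at h
  obtain ⟨A, -, h1, h2⟩ := mutuallySingular_posPart_negPart hab hf
  by_cases hb : b ∈ A
  · have : posPart hab hf {b} = 0 := measure_mono_null (singleton_subset_iff.2 hb) h1
    exact ⟨this, h ▸ this⟩
  · have : negPart hab hf {b} = 0 := measure_mono_null (singleton_subset_iff.2 hb) h2
    exact ⟨h.trans this, this⟩

theorem enorm_D_le {A : Set ℝ} (hA : MeasurableSet A) :
    ‖D hab hf A‖ₑ ≤ (∫⁻ x in A, ‖density hab hf x‖ₑ) + absDs hab hf A := by
  have h := SignedMeasure.singularPart_add_withDensity_rnDeriv_eq (s := D hab hf)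
    (μ := volume)
  rw [← h, add_apply, add_comm]
  refine (enorm_add_le _ _).trans (add_le_add ?_ ?_)
  · change ‖volume.withDensityᵥ (density hab hf) A‖ₑ ≤ _
    rw [withDensityᵥ_apply (integrable_density hab hf) hA]
    exact enorm_integral_le_lintegral_enorm _
  · rw [SignedMeasure.apply_eq_posPart_real_sub_negPart_real _ hA, absDs,
      SignedMeasure.totalVariation, Measure.add_apply]
    refine (enorm_sub_le).trans (add_le_add ?_ ?_) <;>
    · rw [Real.enorm_of_nonneg measureReal_nonneg, ofReal_measureReal]

theorem enorm_sub_le_lintegral_add (hleft : ∀ x ∈ Ioc a b, ContinuousWithinAt f (Iic x) x)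
    {s t : ℝ} (hst : s ≤ t) (hs : s ∈ Icc a b) (ht : t ∈ Icc a b) :
    ‖f t - f s‖ₑ ≤ (∫⁻ x in Ico s t, ‖density hab hf x‖ₑ) + absDs hab hf (Ico s t) := by
  rw [← D_Ico hab hf hleft hst hs ht]
  exact enorm_D_le hab hf measurableSet_Ico

end Derivative

/-! ### Almost everywhere differentiability of `f` -/

section DistributionFunction

variable (m : Measure ℝ) [IsFiniteMeasure m]

theorem monotone_measureReal_Iio : Monotone fun x => m.real (Iio x) :=
  fun _ _ h => measureReal_mono (Iio_subset_Iio h)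

theorem rightLim_measureReal_Iio (x : ℝ) :
    Function.rightLim (fun x => m.real (Iio x)) x = m.real (Iic x) := by
  have h1 := (monotone_measureReal_Iio m).tendsto_rightLim x
  obtain ⟨u, hu, hu', hux⟩ := exists_seq_strictAnti_tendsto x
  have h2 := h1.comp (tendsto_nhdsWithin_iff.2 ⟨hux, Eventually.of_forall hu'⟩)
  refine tendsto_nhds_unique h2 ?_
  have h3 : Iic x = ⋂ n, Iio (u n) := by
    ext y
    simp only [mem_Iic, mem_iInter, mem_Iio]
    exact ⟨fun h n => h.trans_lt (hu' n), fun h => ge_of_tendsto' hux fun n => (h n).le⟩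
  rw [h3]
  exact (ENNReal.tendsto_toReal (measure_ne_top _ _)).comp
    (tendsto_measure_iInter_atTop (fun n => measurableSet_Iio.nullMeasurableSet)
      (fun i j hij => Iio_subset_Iio (hu.antitone hij)) ⟨0, measure_ne_top _ _⟩)

theorem stieltjesFunction_measureReal_Iio :
    (monotone_measureReal_Iio m).stieltjesFunction.measure = m := by
  refine Measure.ext_of_Ioc _ _ fun s t hst => ?_
  rw [StieltjesFunction.measure_Ioc, Monotone.stieltjesFunction_eq, Monotone.stieltjesFunction_eq,
    rightLim_measureReal_Iio, rightLim_measureReal_Iio, ← Iic_sdiff_Iic,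
    ← measureReal_sdiff (Iic_subset_Iic.2 hst.le) measurableSet_Iic, ofReal_measureReal]

theorem ae_hasDerivAt_measureReal_Iio :
    ∀ᵐ x, HasDerivAt (fun x => m.real (Iio x)) (m.rnDeriv volume x).toReal x := by
  have h := (monotone_measureReal_Iio m).ae_hasDerivAt
  rwa [stieltjesFunction_measureReal_Iio] at h

theorem measureReal_Ico_eq_sub {s t : ℝ} (hst : s ≤ t) :
    m.real (Ico s t) = m.real (Iio t) - m.real (Iio s) := by
  rw [← Iio_sdiff_Iio, measureReal_sdiff (Iio_subset_Iio hst) measurableSet_Iio]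

end DistributionFunction

/-- The linearization errors at `s` and `t` are at most `ε (x - s)` and `ε (t - x)`, which add up to
`ε (t - s)` because `x` lies between them. -/
theorem _root_.HasDerivAt.exists_abs_slope_sub_le {F : ℝ → ℝ} {F' x : ℝ} (h : HasDerivAt F F' x)
    {ε : ℝ} (hε : 0 < ε) :
    ∃ δ > 0, ∀ s t, s ≤ x → x ≤ t → s < t → t - s < δ → |(F t - F s) / (t - s) - F'| ≤ ε := by
  obtain ⟨δ, hδ, H⟩ := Metric.eventually_nhds_iff.1 ((hasDerivAt_iff_isLittleO.1 h).def hε)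
  refine ⟨δ, hδ, fun s t hs ht hst hd => ?_⟩
  have h1 := H (y := s) (by rw [Real.dist_eq, abs_sub_comm, abs_of_nonneg] <;> linarith)
  have h2 := H (y := t) (by rw [Real.dist_eq, abs_of_nonneg] <;> linarith)
  rw [Real.norm_eq_abs, Real.norm_eq_abs, smul_eq_mul] at h1 h2
  rw [abs_of_nonpos (sub_nonpos.2 hs)] at h1
  rw [abs_of_nonneg (sub_nonneg.2 ht)] at h2
  have hpos := sub_pos.2 hst
  rw [div_sub' hpos.ne', abs_div, abs_of_pos hpos, div_le_iff₀ hpos]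
  rw [abs_le] at *
  constructor <;> linarith

/-- On `[a, b]`, `f` is up to a constant the difference of the distribution functions of the two
Jordan parts; each is differentiable a.e. with derivative the density of its measure. -/
theorem ae_exists_abs_slope_sub_density_le {a b : ℝ} {f : ℝ → ℝ} (hab : a ≤ b)
    (hf : BoundedVariationOn f (Icc a b)) (hleft : ∀ x ∈ Ioc a b, ContinuousWithinAt f (Iic x) x) :
    ∀ᵐ x, ∀ ε > 0, ∃ δ > 0, ∀ s ∈ Icc a b, ∀ t ∈ Icc a b, s ≤ x → x ≤ t → s < t → t - s < δ →
      |(f t - f s) / (t - s) - density hab hf x| ≤ ε := by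
  filter_upwards [ae_hasDerivAt_measureReal_Iio (posPart hab hf),
    ae_hasDerivAt_measureReal_Iio (negPart hab hf)] with x h1 h2 ε hε
  obtain ⟨δ, hδ, H⟩ := (h1.sub h2).exists_abs_slope_sub_le hε
  refine ⟨δ, hδ, fun s hs t ht hsx hxt hst hd => ?_⟩
  have h3 := H s t hsx hxt hst hd
  rw [sub_eq_posPart_sub_negPart hab hf hleft hst.le hs ht, measureReal_Ico_eq_sub _ hst.le,
    measureReal_Ico_eq_sub _ hst.le, density_eq]
  simp only [Pi.sub_apply] at h3
  convert h3 using 3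
  ring

theorem coe_varExp {p : ℝ → ℝ} {x : ℝ} (hx : 0 ≤ p x) (t : ℝ≥0) :
    varExp p x t = (t : ℝ≥0∞) ^ p x := by
  rw [varExp, ENNReal.coe_rpow_of_nonneg _ hx]

/-! ### The log-Hölder condition and inequalities between powers -/

section LogHolder

variable {p : ℝ → ℝ} {Ω : Set ℝ}

theorem one_le_log_exp_one_add {r : ℝ} (hr : 0 ≤ r) : 1 ≤ Real.log (Real.exp 1 + 1 / r) := by
  rw [Real.le_log_iff_exp_le (by positivity)]
  linarith [one_div_nonneg.2 hr]

theorem StrongLogHolder.continuousOn (hp : StrongLogHolder p Ω) : ContinuousOn p Ω := by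
  refine Metric.continuousOn_iff.2 fun y hy ε hε => ?_
  obtain ⟨δ, hδ, H⟩ := hp ε hε
  refine ⟨δ, hδ, fun x hx hxy => ?_⟩
  rcases eq_or_ne x y with rfl | hne
  · simpa using hε
  · have h1 := H y hy x hx hne hxy
    have h2 := one_le_log_exp_one_add (abs_nonneg (x - y))
    rw [Real.dist_eq]
    nlinarith [abs_nonneg (p x - p y)]

/-- The form used on an interval of length `L`: the logarithm decreases in the distance, and the
summand `e` keeps it at least `1`, which bounds the oscillation itself. -/
theorem StrongLogHolder.exists_forall_le (hp : StrongLogHolder p Ω) {ε : ℝ} (hε : 0 < ε) :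
    ∃ δ > 0, ∀ x ∈ Ω, ∀ y ∈ Ω, ∀ L, |x - y| ≤ L → 0 < L → L < δ →
      |p x - p y| ≤ ε ∧ |p x - p y| * Real.log (1 / L) ≤ ε := by
  obtain ⟨δ, hδ, H⟩ := hp ε hε
  refine ⟨δ, hδ, fun x hx y hy L hL hL0 hLδ => ?_⟩
  rcases eq_or_ne x y with rfl | hne
  · simp [hε.le]
  have h1 := H y hy x hx hne (hL.trans_lt hLδ)
  have h0 : 0 < |x - y| := abs_pos.2 (sub_ne_zero.2 hne)
  have h2 := one_le_log_exp_one_add h0.le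
  have h3 : Real.log (1 / L) ≤ Real.log (Real.exp 1 + 1 / |x - y|) := by
    refine Real.log_le_log (by positivity) ?_
    have := one_div_le_one_div_of_le h0 hL
    linarith [Real.exp_pos 1]
  have h4 := abs_nonneg (p x - p y)
  constructor
  · nlinarith
  · nlinarith

end LogHolder

/-- For `0 < x < 1`, `x ^ q - x ^ r ≤ (r - q) x ^ q (-log x)`, and `x ^ q (-log x) ≤ x (-log x) ≤ 1`
as `q ≥ 1`. -/
theorem rpow_le_rpow_add_sub {x q r : ℝ} (hx : 0 ≤ x) (hq : 1 ≤ q) (hqr : q ≤ r) :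
    x ^ q ≤ x ^ r + (r - q) := by
  rcases hx.eq_or_lt with rfl | hx
  · rw [Real.zero_rpow (by linarith), Real.zero_rpow (by linarith)]
    linarith
  rcases le_or_gt 1 x with h1 | h1
  · linarith [Real.rpow_le_rpow_of_exponent_le h1 hqr]
  have e : x ^ r = x ^ q * x ^ (r - q) := by rw [← Real.rpow_add hx]; ring_nf
  have h2 : 1 + (r - q) * Real.log x ≤ x ^ (r - q) := by
    rw [Real.rpow_def_of_pos hx]
    linarith [Real.add_one_le_exp (Real.log x * (r - q))]
  have h3 : x ^ q ≤ x := by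
    simpa using Real.rpow_le_rpow_of_exponent_ge hx h1.le hq
  have h4 : - Real.log x ≤ x⁻¹ - 1 := by
    rw [← Real.log_inv]; exact Real.log_le_sub_one_of_pos (inv_pos.2 hx)
  have h5 : 0 < x ^ q := Real.rpow_pos_of_pos hx q
  have h6 : x ^ q * (- Real.log x) ≤ 1 := by
    have : 0 ≤ - Real.log x := by linarith [Real.log_nonpos hx.le h1.le]
    calc x ^ q * (- Real.log x) ≤ x * (x⁻¹ - 1) := by gcongr
      _ ≤ 1 := by rw [mul_sub, mul_inv_cancel₀ hx.ne']; linarith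
  have h7 := mul_le_mul_of_nonneg_left h2 h5.le
  have h8 := mul_le_mul_of_nonneg_left h6 (sub_nonneg.2 hqr)
  rw [e]
  linarith

theorem enorm_rpow_le_varExp_add {p : ℝ → ℝ} {x q η : ℝ} (hq : 1 ≤ q) (hqx : q ≤ p x)
    (hη : p x - q ≤ η) (t : ℝ) : ‖t‖ₑ ^ q ≤ varExp p x ‖t‖₊ + ENNReal.ofReal η := by
  have h := rpow_le_rpow_add_sub (norm_nonneg t) hq hqx
  rw [coe_varExp (by linarith), ← enorm_eq_nnnorm, ← ofReal_norm,
    ENNReal.ofReal_rpow_of_nonneg (norm_nonneg t) (by linarith),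
    ENNReal.ofReal_rpow_of_nonneg (norm_nonneg t) (by linarith),
    ← ENNReal.ofReal_add (by positivity) (by linarith)]
  exact ENNReal.ofReal_le_ofReal (by linarith)

theorem rpow_le_exp_mul_rpow {w L V q r ε : ℝ} (hw : 0 ≤ w) (hL : 0 < L) (hV : 1 ≤ V)
    (hwV : w * L ≤ V) (hq : 1 ≤ q) (hqr : q ≤ r) (hε : r - q ≤ ε)
    (hlog : (r - q) * Real.log (1 / L) ≤ ε) :
    w ^ r ≤ Real.exp (ε * (1 + Real.log V)) * w ^ q := by
  have hV0 := Real.log_nonneg hV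
  have hε0 : 0 ≤ ε := by linarith
  have hC : 1 ≤ Real.exp (ε * (1 + Real.log V)) := Real.one_le_exp (by positivity)
  rcases hw.eq_or_lt with rfl | hw
  · rw [Real.zero_rpow (by linarith), Real.zero_rpow (by linarith), mul_zero]
  rcases le_or_gt w 1 with h1 | h1
  · calc w ^ r ≤ w ^ q := Real.rpow_le_rpow_of_exponent_ge hw h1 hqr
      _ ≤ _ := le_mul_of_one_le_left (by positivity) hC
  have e : w ^ r = w ^ (r - q) * w ^ q := by rw [← Real.rpow_add hw]; ring_nf
  rw [e, Real.rpow_def_of_pos hw (r - q)]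
  refine mul_le_mul_of_nonneg_right (Real.exp_le_exp.2 ?_) (by positivity)
  have h2 : Real.log w ≤ Real.log V + Real.log (1 / L) := by
    rw [← Real.log_mul (by positivity) (by positivity)]
    refine Real.log_le_log hw ?_
    rw [mul_one_div, le_div_iff₀ hL]
    exact hwV
  have h3 := mul_le_mul_of_nonneg_right h2 (sub_nonneg.2 hqr)
  have h4 := mul_le_mul_of_nonneg_right hε hV0
  linarith

theorem rpow_mul_le_lintegral_rpow {g : ℝ → ℝ} (hg : Measurable g) {I : Set ℝ} {w L : ℝ≥0∞}
    (hI : volume I = L) (hL0 : L ≠ 0) (hL : L ≠ ∞) {q : ℝ} (hq : 1 ≤ q)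
    (h : w * L ≤ ∫⁻ x in I, ‖g x‖ₑ) : w ^ q * L ≤ ∫⁻ x in I, ‖g x‖ₑ ^ q := by
  have h1 := eLpNorm'_le_eLpNorm'_mul_rpow_measure_univ (μ := volume.restrict I) one_pos hq
    hg.aestronglyMeasurable
  have hq0 : 0 < q := by linarith
  rw [eLpNorm'_eq_lintegral_enorm, eLpNorm'_eq_lintegral_enorm, Measure.restrict_apply_univ, hI] at h1
  simp only [ENNReal.rpow_one, div_one] at h1
  have h2 := ENNReal.rpow_le_rpow (h.trans h1) hq0.le
  rw [ENNReal.mul_rpow_of_nonneg _ _ hq0.le, ENNReal.mul_rpow_of_nonneg _ _ hq0.le,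
    ← ENNReal.rpow_mul, ← ENNReal.rpow_mul, one_div_mul_cancel hq0.ne', ENNReal.rpow_one] at h2
  -- Hölder's inequality produces the factor `L ^ (q - 1)`; cancelling it from `w ^ q * L ^ q`
  -- leaves the single factor `L`.
  have e : (1 - 1 / q) * q = q - 1 := by field_simp
  have e2 : L ^ q = L * L ^ (q - 1) := by
    conv_rhs => rw [← ENNReal.rpow_one L, ← ENNReal.rpow_mul, one_mul, ← ENNReal.rpow_add _ _ hL0 hL]
    ring_nf
  rw [e, e2, ← mul_assoc] at h2
  exact (ENNReal.mul_le_mul_iff_left (ENNReal.rpow_pos (pos_iff_ne_zero.2 hL0) hL).ne'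
    (ENNReal.rpow_ne_top_of_ne_zero hL0 hL)).1 h2

theorem nnnorm_div_mul_ofReal {d L : ℝ} (hL : 0 < L) :
    (‖d / L‖₊ : ℝ≥0∞) * ENNReal.ofReal L = ‖d‖ₑ := by
  rw [← enorm_eq_nnnorm, ← Real.enorm_of_nonneg hL.le, ← enorm_mul, div_mul_cancel₀ _ hL.ne']

/-! ### Upper bound for the variation -/

section UpperBound

variable {a b : ℝ} {f : ℝ → ℝ} {p : ℝ → ℝ} (hab : a ≤ b) (hf : BoundedVariationOn f (Icc a b))

theorem phiPlus_mul_len_le (hleft : ∀ x ∈ Ioc a b, ContinuousWithinAt f (Iic x) x)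
    (hp_one : ∀ x ∈ Icc a b, 1 ≤ p x) (hp : ContinuousOn p (Icc a b))
    (hs : absDs hab hf {x ∈ Icc a b | 1 < p x} = 0) {V : ℝ} (hV : 1 ≤ V)
    (hfV : ∀ x ∈ Icc a b, ∀ y ∈ Icc a b, |f y - f x| ≤ V) (P : Partition a b) (k : Fin P.n) {ε : ℝ}
    (hε : ∀ x ∈ P.interval k, ∀ y ∈ P.interval k,
      |p x - p y| ≤ ε ∧ |p x - p y| * Real.log (1 / P.len k) ≤ ε) :
    phiPlus (varExp p) (P.interval k) ‖(f (P.t k.succ) - f (P.t k.castSucc)) / P.len k‖₊ *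
        ENNReal.ofReal (P.len k) ≤
      ENNReal.ofReal (Real.exp (ε * (1 + Real.log V))) *
        ((∫⁻ x in P.cell k, varExp p x ‖density hab hf x‖₊) +
          ENNReal.ofReal ε * volume (P.cell k) + absDs hab hf (P.cell k)) := by
  set d := f (P.t k.succ) - f (P.t k.castSucc) with hd
  have hL := P.len_pos k
  have hsub := P.interval_subset k
  obtain ⟨z, hz, hzmin⟩ := isCompact_Icc.exists_isMinOn
    (nonempty_Icc.2 (P.castSucc_lt_succ k).le) (hp.mono hsub)
  have hz1 := hp_one z (hsub hz)
  have hint : ∫⁻ x in P.cell k, ‖density hab hf x‖ₑ ^ p z ≤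
      (∫⁻ x in P.cell k, varExp p x ‖density hab hf x‖₊) +
        ENNReal.ofReal ε * volume (P.cell k) := by
    rw [← setLIntegral_const, ← lintegral_add_right _ measurable_const]
    refine setLIntegral_mono' (P.measurableSet_cell k) fun x hx => ?_
    have hx' := P.cell_subset_interval k hx
    exact enorm_rpow_le_varExp_add hz1 (hzmin hx') ((le_abs_self _).trans (hε x hx' z hz).1) _
  have hvol := P.volume_cell k
  have hL0 : ENNReal.ofReal (P.len k) ≠ 0 := (ENNReal.ofReal_pos.2 hL).ne'
  have hdbound : ‖d‖ₑ ≤ (∫⁻ x in P.cell k, ‖density hab hf x‖ₑ) + absDs hab hf (P.cell k) :=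
    enorm_sub_le_lintegral_add hab hf hleft (P.castSucc_lt_succ k).le (P.t_mem_Icc _)
      (P.t_mem_Icc _)
  have hq : (‖d / P.len k‖₊ : ℝ≥0∞) ^ p z * ENNReal.ofReal (P.len k) ≤
      (∫⁻ x in P.cell k, varExp p x ‖density hab hf x‖₊) +
        ENNReal.ofReal ε * volume (P.cell k) + absDs hab hf (P.cell k) := by
    -- Either the increment is absolutely continuous and Jensen applies, or the cell carries
    -- singular mass, which by `hs` forces the minimal exponent to be `1`.
    rcases eq_or_ne (absDs hab hf (P.cell k)) 0 with h0 | h0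
    · rw [h0, add_zero] at hdbound ⊢
      refine le_trans ?_ hint
      refine rpow_mul_le_lintegral_rpow (measurable_density hab hf) hvol hL0 ENNReal.ofReal_ne_top
        hz1 ?_
      rwa [nnnorm_div_mul_ofReal hL]
    · have hz' : p z = 1 := by
        by_contra hne
        refine h0 (measure_mono_null (fun x hx => ?_) hs)
        have hx' := P.cell_subset_interval k hx
        exact ⟨hsub hx', (lt_of_le_of_ne hz1 (Ne.symm hne)).trans_le (hzmin hx')⟩
      rw [hz'] at hint ⊢
      simp only [ENNReal.rpow_one] at hint ⊢
      rw [nnnorm_div_mul_ofReal hL]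
      exact hdbound.trans (by gcongr)
  have hphi : phiPlus (varExp p) (P.interval k) ‖d / P.len k‖₊ ≤
      ENNReal.ofReal (Real.exp (ε * (1 + Real.log V))) * (‖d / P.len k‖₊ : ℝ≥0∞) ^ p z := by
    refine iSup₂_le fun x hx => ?_
    have hzx : p z ≤ p x := hzmin hx
    obtain ⟨h1, h2⟩ := hε x hx z hz
    rw [abs_of_nonneg (sub_nonneg.2 hzx)] at h1 h2
    rw [coe_varExp (by linarith), ← enorm_eq_nnnorm, ← ofReal_norm,
      ENNReal.ofReal_rpow_of_nonneg (norm_nonneg _) (by linarith),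
      ENNReal.ofReal_rpow_of_nonneg (norm_nonneg _) (by linarith),
      ← ENNReal.ofReal_mul (Real.exp_pos _).le]
    refine ENNReal.ofReal_le_ofReal (rpow_le_exp_mul_rpow (norm_nonneg _) hL hV ?_ hz1 hzx h1 h2)
    rw [norm_div, Real.norm_eq_abs, Real.norm_eq_abs, abs_of_pos hL, div_mul_cancel₀ _ hL.ne']
    exact hfV _ (P.t_mem_Icc _) _ (P.t_mem_Icc _)
  calc _ ≤ _ := mul_le_mul_left hphi _
    _ ≤ _ := by rw [mul_assoc]; gcongr

theorem eventually_rieszSum_le (hleft : ∀ x ∈ Ioc a b, ContinuousWithinAt f (Iic x) x)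
    {Ω : Set ℝ} (hΩ : Icc a b ⊆ Ω) (hp_one : ∀ x ∈ Ω, 1 ≤ p x) (hp_log : StrongLogHolder p Ω)
    (hs : absDs hab hf {x ∈ Icc a b | 1 < p x} = 0) {V : ℝ} (hV : 1 ≤ V)
    (hfV : ∀ x ∈ Icc a b, ∀ y ∈ Icc a b, |f y - f x| ≤ V) {ε : ℝ} (hε : 0 < ε) :
    ∀ᶠ P : Partition a b in Partition.fine a b, rieszSum (varExp p) f P ≤
      ENNReal.ofReal (Real.exp (ε * (1 + Real.log V))) *
        ((∫⁻ x in Icc a b, varExp p x ‖density hab hf x‖₊) +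
          ENNReal.ofReal ε * volume (Ico a b) + absDs hab hf {x ∈ Icc a b | p x = 1}) := by
  obtain ⟨δ, hδ, H⟩ := hp_log.exists_forall_le hε
  filter_upwards [Partition.eventually_len_lt hδ] with P hP
  refine (Finset.sum_le_sum fun k _ => phiPlus_mul_len_le hab hf hleft
    (fun x hx => hp_one x (hΩ hx)) (hp_log.continuousOn.mono hΩ) hs hV hfV P k (ε := ε)
    fun x hx y hy => H x (hΩ (P.interval_subset k hx)) y (hΩ (P.interval_subset k hy)) _
      (P.abs_sub_le_len hx hy) (P.len_pos k) (hP k)).trans ?_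
  rw [← Finset.mul_sum, Finset.sum_add_distrib, Finset.sum_add_distrib, ← Finset.mul_sum,
    P.sum_lintegral_cell, P.sum_measure_cell_univ, P.sum_measure_cell_univ]
  refine mul_le_mul' le_rfl
    (add_le_add (add_le_add (lintegral_mono_set Ico_subset_Icc_self) le_rfl) ?_)
  have h : Ico a b ⊆ {x ∈ Icc a b | p x = 1} ∪ {x ∈ Icc a b | 1 < p x} := fun x hx =>
    (hp_one x (hΩ (Ico_subset_Icc_self hx))).eq_or_lt.imp
      (fun h => ⟨Ico_subset_Icc_self hx, h.symm⟩) fun h => ⟨Ico_subset_Icc_self hx, h⟩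
  refine (measure_mono h).trans ((measure_union_le _ _).trans ?_)
  rw [hs, add_zero]

theorem upperVariation_le (hleft : ∀ x ∈ Ioc a b, ContinuousWithinAt f (Iic x) x)
    {Ω : Set ℝ} (hΩ : Icc a b ⊆ Ω) (hp_one : ∀ x ∈ Ω, 1 ≤ p x) (hp_log : StrongLogHolder p Ω)
    (hs : absDs hab hf {x ∈ Icc a b | 1 < p x} = 0) :
    upperVariation (varExp p) a b f ≤
      (∫⁻ x in Icc a b, varExp p x ‖density hab hf x‖₊) +
        absDs hab hf {x ∈ Icc a b | p x = 1} := by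
  -- The maximum with `1` makes `log V` nonnegative.
  set V := max 1 (eVariationOn f (Icc a b)).toReal with hVdef
  have hfV : ∀ x ∈ Icc a b, ∀ y ∈ Icc a b, |f y - f x| ≤ V := fun x hx y hy =>
    (Real.dist_eq (f y) (f x) ▸ hf.dist_le hy hx).trans (le_max_right _ _)
  set A := ∫⁻ x in Icc a b, varExp p x ‖density hab hf x‖₊
  set B := absDs hab hf {x ∈ Icc a b | p x = 1}
  have hlim : Tendsto (fun ε : ℝ => ENNReal.ofReal (Real.exp (ε * (1 + Real.log V))) *
      (A + ENNReal.ofReal ε * volume (Ico a b) + B)) (𝓝[>] 0)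
      (𝓝 (ENNReal.ofReal (Real.exp (0 * (1 + Real.log V))) *
      (A + ENNReal.ofReal 0 * volume (Ico a b) + B))) := by
    refine Tendsto.mono_left ?_ nhdsWithin_le_nhds
    refine ENNReal.Tendsto.mul ((ENNReal.continuous_ofReal.comp (by fun_prop)).tendsto 0) (Or.inl ?_) ?_ (Or.inr ?_)
    · simp
    · refine (tendsto_const_nhds.add (ENNReal.Tendsto.mul_const ?_ (Or.inr ?_))).add
        tendsto_const_nhds
      · exact ENNReal.continuous_ofReal.tendsto 0
      · rw [Real.volume_Ico]; exact ENNReal.ofReal_ne_top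
    · exact ENNReal.ofReal_ne_top
  simp only [zero_mul, Real.exp_zero, ENNReal.ofReal_one, one_mul, ENNReal.ofReal_zero,
    add_zero] at hlim
  refine ge_of_tendsto hlim ?_
  filter_upwards [self_mem_nhdsWithin] with ε hε
  exact limsup_le_of_le (by isBoundedDefault)
    (eventually_rieszSum_le hab hf hleft hΩ hp_one hp_log hs (le_max_left _ _) hfV hε)

end UpperBound

/-! ### Lower bound for the variation -/

/-- Inner regularity gives `K`. Since `ν K = 0`, the cells meeting `K` have small `ν`-mass, so
cancellation between `μ` and `ν` is negligible there and the increments see almost all of `μ E`. It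
is applied to the Jordan parts in both orders. -/
theorem exists_isCompact_eventually_measure_le {a b : ℝ} {f : ℝ → ℝ} {μ ν : Measure ℝ}
    [IsFiniteMeasure μ] [IsFiniteMeasure ν]
    (h : ∀ s ∈ Icc a b, ∀ t ∈ Icc a b, s ≤ t → μ (Ico s t) ≤ ν (Ico s t) + ‖f t - f s‖ₑ)
    {E : Set ℝ} (hE : MeasurableSet E) (hEab : E ⊆ Ico a b) (hνE : ν E = 0) {ε : ℝ≥0∞}
    (hε : ε ≠ 0) :
    ∃ K ⊆ E, IsCompact K ∧ ∀ᶠ P : Partition a b in Partition.fine a b,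
      μ E ≤ (∑ k ∈ P.meeting K, ‖f (P.t k.succ) - f (P.t k.castSucc)‖ₑ) + ε := by
  have hε2 : ε / 2 ≠ 0 := (ENNReal.half_pos hε).ne'
  obtain ⟨K, hKE, hK, hμ⟩ := hE.exists_isCompact_lt_add (measure_ne_top μ E) hε2
  refine ⟨K, hKE, hK, ?_⟩
  filter_upwards [Partition.eventually_measure_meeting_le ν hK (measure_mono_null hKE hνE) hε2]
    with P hP
  calc μ E ≤ μ K + ε / 2 := hμ.le
    _ ≤ (∑ k ∈ P.meeting K, μ (P.cell k)) + ε / 2 := by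
      rw [P.sum_measure_cell]
      exact add_le_add (measure_mono (P.subset_iUnion_cell_meeting (hKE.trans hEab))) le_rfl
    _ ≤ ((∑ k ∈ P.meeting K, ν (P.cell k)) +
        ∑ k ∈ P.meeting K, ‖f (P.t k.succ) - f (P.t k.castSucc)‖ₑ) + ε / 2 := by
      rw [← Finset.sum_add_distrib]
      exact add_le_add (Finset.sum_le_sum fun k _ => h _ (P.t_mem_Icc _) _ (P.t_mem_Icc _)
        (P.castSucc_lt_succ k).le) le_rfl
    _ ≤ (ε / 2 + ∑ k ∈ P.meeting K, ‖f (P.t k.succ) - f (P.t k.castSucc)‖ₑ) + ε / 2 := by gcongr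
    _ = _ := by rw [add_comm (ε / 2), add_assoc, ENNReal.add_halves]

section LowerBound

variable {a b : ℝ} {f : ℝ → ℝ} {p : ℝ → ℝ} (hab : a ≤ b) (hf : BoundedVariationOn f (Icc a b))

theorem posPart_Ico_le (hleft : ∀ x ∈ Ioc a b, ContinuousWithinAt f (Iic x) x) {s t : ℝ}
    (hst : s ≤ t) (hs : s ∈ Icc a b) (ht : t ∈ Icc a b) :
    posPart hab hf (Ico s t) ≤ negPart hab hf (Ico s t) + ‖f t - f s‖ₑ ∧
      negPart hab hf (Ico s t) ≤ posPart hab hf (Ico s t) + ‖f t - f s‖ₑ := by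
  have h := sub_eq_posPart_sub_negPart hab hf hleft hst hs ht
  rw [← ofReal_measureReal, ← ofReal_measureReal, ← ofReal_norm, Real.norm_eq_abs,
    ← ENNReal.ofReal_add measureReal_nonneg (abs_nonneg _),
    ← ENNReal.ofReal_add measureReal_nonneg (abs_nonneg _)]
  constructor
  · exact ENNReal.ofReal_le_ofReal (by linarith [le_abs_self (f t - f s)])
  · exact ENNReal.ofReal_le_ofReal (by linarith [neg_abs_le (f t - f s)])

theorem exists_measurableSet_absDs_le (hleft : ∀ x ∈ Ioc a b, ContinuousWithinAt f (Iic x) x)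
    {B : Set ℝ} (hB : MeasurableSet B) (hBab : B ⊆ Icc a b) :
    ∃ E₁ E₂, MeasurableSet E₁ ∧ MeasurableSet E₂ ∧ E₁ ⊆ B ∩ Ico a b ∧ E₂ ⊆ B ∩ Ico a b ∧
      Disjoint E₁ E₂ ∧ volume (E₁ ∪ E₂) = 0 ∧ negPart hab hf E₁ = 0 ∧ posPart hab hf E₂ = 0 ∧
      absDs hab hf B ≤ posPart hab hf E₁ + negPart hab hf E₂ := by
  obtain ⟨A, hA, hA1, hA2⟩ := mutuallySingular_posPart_negPart hab hf
  have hsing : absDs hab hf ⟂ₘ volume := by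
    rw [absDs_eq]
    exact (Measure.mutuallySingular_singularPart _ _).add_left
      (Measure.mutuallySingular_singularPart _ _)
  obtain ⟨N, hN, hN1, hN2⟩ := hsing
  obtain ⟨hb1, hb2⟩ := posPart_add_negPart_singleton_right hab hf hleft
  -- `Nᶜ` is Lebesgue-null and carries `|Dˢf|`; the Hahn set `A` then splits `C` into a positive
  -- piece `C ∩ Aᶜ` and a negative piece `C ∩ A`.
  set C := B ∩ Ico a b ∩ Nᶜ with hC
  have hCm : MeasurableSet C := (hB.inter measurableSet_Ico).inter hN.compl
  refine ⟨C ∩ Aᶜ, C ∩ A, hCm.inter hA.compl, hCm.inter hA, ?_, ?_, ?_, ?_, ?_, ?_, ?_⟩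
  · exact fun x hx => hx.1.1
  · exact fun x hx => hx.1.1
  · exact disjoint_left.2 fun x hx hx' => hx.2 hx'.2
  · exact measure_mono_null (fun x hx => hx.elim (fun h => h.1.2) fun h => h.1.2) hN2
  · exact measure_mono_null inter_subset_right hA2
  · exact measure_mono_null inter_subset_right hA1
  · have hBsub : B ⊆ (C ∩ Aᶜ ∪ C ∩ A) ∪ N ∪ {b} := by
      intro x hx
      by_cases hxN : x ∈ N
      · exact Or.inl (Or.inr hxN)
      · rcases (hBab hx).2.eq_or_lt with h | h
        · exact Or.inr h
        · left; left
          rw [← inter_union_distrib_left, compl_union_self, inter_univ]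
          exact ⟨⟨hx, (hBab hx).1, h⟩, hxN⟩
    have hb : absDs hab hf {b} = 0 := by
      rw [absDs_eq, Measure.add_apply]
      have h1 := Measure.singularPart_le (posPart hab hf) volume {b}
      have h2 := Measure.singularPart_le (negPart hab hf) volume {b}
      rw [hb1] at h1
      rw [hb2] at h2
      rw [nonpos_iff_eq_zero.1 h1, nonpos_iff_eq_zero.1 h2, add_zero]
    have hle : ∀ S, absDs hab hf S ≤ posPart hab hf S + negPart hab hf S := fun S => by
      rw [absDs_eq, Measure.add_apply]
      exact add_le_add (Measure.singularPart_le _ _ S) (Measure.singularPart_le _ _ S)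
    have h1 : negPart hab hf (C ∩ Aᶜ) = 0 := measure_mono_null inter_subset_right hA2
    have h2 : posPart hab hf (C ∩ A) = 0 := measure_mono_null inter_subset_right hA1
    calc absDs hab hf B ≤ absDs hab hf ((C ∩ Aᶜ ∪ C ∩ A) ∪ N ∪ {b}) := measure_mono hBsub
      _ ≤ absDs hab hf (C ∩ Aᶜ) + absDs hab hf (C ∩ A) + absDs hab hf N + absDs hab hf {b} :=
        (measure_union_le _ _).trans (add_le_add ((measure_union_le _ _).trans
          (add_le_add (measure_union_le _ _) le_rfl)) le_rfl)
      _ ≤ _ := by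
        rw [hN1, hb, add_zero, add_zero]
        refine add_le_add ((hle _).trans ?_) ((hle _).trans ?_)
        · rw [h1, add_zero]
        · rw [h2, zero_add]

theorem exists_isCompact_eventually_absDs_le
    (hleft : ∀ x ∈ Ioc a b, ContinuousWithinAt f (Iic x) x) {B : Set ℝ} (hB : MeasurableSet B)
    (hBab : B ⊆ Icc a b) {ε : ℝ≥0∞} (hε : ε ≠ 0) :
    ∃ K ⊆ B, IsCompact K ∧ volume K = 0 ∧ ∀ᶠ P : Partition a b in Partition.fine a b,
      absDs hab hf B ≤ (∑ k ∈ P.meeting K, ‖f (P.t k.succ) - f (P.t k.castSucc)‖ₑ) + ε := by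
  obtain ⟨E₁, E₂, hE₁, hE₂, hE₁B, hE₂B, hdisj, hvol, hn, hp, hle⟩ :=
    exists_measurableSet_absDs_le hab hf hleft hB hBab
  have hε2 : ε / 2 ≠ 0 := (ENNReal.half_pos hε).ne'
  obtain ⟨K₁, hK₁E, hK₁, h₁⟩ := exists_isCompact_eventually_measure_le
    (fun s hs t ht hst => (posPart_Ico_le hab hf hleft hst hs ht).1) hE₁
    (hE₁B.trans inter_subset_right) hn hε2
  obtain ⟨K₂, hK₂E, hK₂, h₂⟩ := exists_isCompact_eventually_measure_le
    (fun s hs t ht hst => (posPart_Ico_le hab hf hleft hst hs ht).2) hE₂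
    (hE₂B.trans inter_subset_right) hp hε2
  refine ⟨K₁ ∪ K₂, union_subset (hK₁E.trans (hE₁B.trans inter_subset_left))
    (hK₂E.trans (hE₂B.trans inter_subset_left)), hK₁.union hK₂,
    measure_mono_null (union_subset_union hK₁E hK₂E) hvol, ?_⟩
  -- Disjoint compacts have positive distance, so on fine partitions no increment is counted for
  -- both signs.
  filter_upwards [h₁, h₂, Partition.eventually_disjoint_meeting hK₁ hK₂ (hdisj.mono hK₁E hK₂E)]
    with P hP₁ hP₂ hP
  rw [P.meeting_union, Finset.sum_union hP]
  refine hle.trans ((add_le_add hP₁ hP₂).trans_eq ?_)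
  rw [add_add_add_comm, ENNReal.add_halves]

/-- Fatou's lemma for the step functions equal to `φ⁺` of the slope on cells whose closed interval
avoids `K`. As `K` is closed and null, almost every point eventually lies in such a cell, where the
slope tends to `f'`. -/
theorem lintegral_le_liminf (hleft : ∀ x ∈ Ioc a b, ContinuousWithinAt f (Iic x) x)
    (hp_one : ∀ x ∈ Icc a b, 1 ≤ p x) {K : Set ℝ} (hK : IsCompact K) (hK0 : volume K = 0) :
    ∫⁻ x in Icc a b, varExp p x ‖density hab hf x‖₊ ≤
      liminf (fun P : Partition a b => ∑ k ∈ (P.meeting K)ᶜ,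
        phiPlus (varExp p) (P.interval k) ‖(f (P.t k.succ) - f (P.t k.castSucc)) / P.len k‖₊ *
          ENNReal.ofReal (P.len k)) (Partition.fine a b) := by
  set c : ∀ P : Partition a b, Fin P.n → ℝ≥0∞ := fun P k =>
    phiPlus (varExp p) (P.interval k) ‖(f (P.t k.succ) - f (P.t k.castSucc)) / P.len k‖₊
  set g : Partition a b → ℝ → ℝ≥0∞ := fun P x =>
    ∑ k ∈ (P.meeting K)ᶜ, (P.cell k).indicator (fun _ => c P k) x
  have hg : ∀ P, Measurable (g P) := fun P =>
    Finset.measurable_fun_sum _ fun k _ => measurable_const.indicator (P.measurableSet_cell k)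
  have hgint : ∀ P, ∫⁻ x in Ico a b, g P x ≤
      ∑ k ∈ (P.meeting K)ᶜ, c P k * ENNReal.ofReal (P.len k) := by
    intro P
    refine (lintegral_mono' Measure.restrict_le_self le_rfl).trans_eq ?_
    rw [lintegral_finsetSum _ fun k _ => measurable_const.indicator (P.measurableSet_cell k)]
    refine Finset.sum_congr rfl fun k _ => ?_
    rw [lintegral_indicator_const (P.measurableSet_cell k), P.volume_cell]
  refine le_trans ?_ ((lintegral_liminf_le (μ := volume.restrict (Ico a b)) hg).trans
    (liminf_le_liminf (Eventually.of_forall hgint)))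
  rw [← setLIntegral_congr (Ico_ae_eq_Icc (μ := volume) (a := a) (b := b))]
  refine lintegral_mono_ae ?_
  refine (ae_restrict_iff' measurableSet_Ico).2 ?_
  filter_upwards [ae_exists_abs_slope_sub_density_le hab hf hleft,
    measure_eq_zero_iff_ae_notMem.1 hK0] with x hx hxK hxI
  have hp0 : 0 ≤ p x := zero_le_one.trans (hp_one x (Ico_subset_Icc_self hxI))
  refine le_of_forall_lt fun r hr => ?_
  obtain ⟨r', hrr', hr'⟩ := exists_between hr
  refine hrr'.trans_le (le_liminf_of_le (by isBoundedDefault) ?_)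
  have hcont : Continuous fun y : ℝ => varExp p x ‖y‖₊ :=
    ENNReal.continuous_coe.comp ((NNReal.continuous_rpow_const hp0).comp continuous_nnnorm)
  obtain ⟨η, hη, hball⟩ := Metric.eventually_nhds_iff.1
    ((hcont.tendsto (density hab hf x)).eventually (lt_mem_nhds hr'))
  obtain ⟨δ, hδ, hslope⟩ := hx (η / 2) (half_pos hη)
  obtain ⟨δ', hδ', hdist⟩ := Metric.isOpen_iff.1 hK.isClosed.isOpen_compl x hxK
  filter_upwards [Partition.eventually_len_lt hδ, Partition.eventually_len_lt hδ'] with P h1 h2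
  obtain ⟨k, hk⟩ := mem_iUnion.1 (P.iUnion_cell.symm ▸ hxI : x ∈ ⋃ k, P.cell k)
  have hkK : k ∈ (P.meeting K)ᶜ := by
    rw [Finset.mem_compl, Partition.mem_meeting]
    rintro ⟨y, hy, hyK⟩
    refine hdist (Metric.mem_ball.2 ?_) hyK
    rw [Real.dist_eq]
    exact (P.abs_sub_le_len hy (P.cell_subset_interval k hk)).trans_lt (h2 k)
  have hs := hslope _ (P.t_mem_Icc k.castSucc) _ (P.t_mem_Icc k.succ) hk.1 hk.2.le
    (P.castSucc_lt_succ k) (h1 k)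
  have hr1 := hball (y := (f (P.t k.succ) - f (P.t k.castSucc)) / P.len k) (by
    rw [Real.dist_eq]
    exact hs.trans_lt (half_lt_self hη))
  calc r' ≤ c P k := hr1.le.trans (le_iSup₂ (f := fun y (_ : y ∈ P.interval k) =>
        varExp p y ‖(f (P.t k.succ) - f (P.t k.castSucc)) / P.len k‖₊) x
          (P.cell_subset_interval k hk))
    _ = (P.cell k).indicator (fun _ => c P k) x := by rw [indicator_of_mem hk]
    _ ≤ g P x := Finset.single_le_sum (f := fun k => (P.cell k).indicator (fun _ => c P k) x)
      (fun _ _ => zero_le) hkK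

theorem le_upperVariation (hab' : a < b) (hleft : ∀ x ∈ Ioc a b, ContinuousWithinAt f (Iic x) x)
    (hp_one : ∀ x ∈ Icc a b, 1 ≤ p x) (hp : ContinuousOn p (Icc a b)) :
    (∫⁻ x in Icc a b, varExp p x ‖density hab hf x‖₊) + absDs hab hf {x ∈ Icc a b | p x = 1} ≤
      upperVariation (varExp p) a b f := by
  have := Partition.fine_neBot hab'
  have hB : MeasurableSet {x ∈ Icc a b | p x = 1} :=
    (hp.preimage_isClosed_of_isClosed isClosed_Icc isClosed_singleton (t := {1})).measurableSet
  refine le_of_forall_pos_le_add fun ε hε => ?_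
  obtain ⟨K, hKB, hK, hK0, hev⟩ := exists_isCompact_eventually_absDs_le hab hf hleft hB
    (fun x hx => hx.1) hε.ne'
  have h := lintegral_le_liminf hab hf hleft hp_one hK hK0
  refine (add_le_add h le_rfl).trans ?_
  rw [← liminf_add_const _ _ _ (by isBoundedDefault) (by isBoundedDefault)]
  rw [upperVariation, ← limsup_add_const _ _ _ (by isBoundedDefault) (by isBoundedDefault)]
  refine (liminf_le_liminf ?_).trans (liminf_le_limsup)
  filter_upwards [hev] with P hP
  rw [rieszSum, ← Finset.sum_compl_add_sum (P.meeting K), add_assoc]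
  refine add_le_add le_rfl (hP.trans (add_le_add (Finset.sum_le_sum fun k hk => ?_) le_rfl))
  -- At a point of `K` the exponent is `1`, so `φ⁺` times the length dominates the increment.
  obtain ⟨x, hx, hxK⟩ := Partition.mem_meeting.1 hk
  rw [← nnnorm_div_mul_ofReal (P.len_pos k)]
  refine mul_le_mul' ?_ le_rfl
  refine le_trans ?_ (le_iSup₂ (f := fun y (_ : y ∈ P.interval k) =>
        varExp p y ‖(f (P.t k.succ) - f (P.t k.castSucc)) / P.len k‖₊) x hx)
  simp [varExp, (hKB hxK).2]

end LowerBound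

/-! ### Vanishing of the singular part where `p > 1` -/

/-- Beyond the threshold `t = N ^ (1 / r)` the factor `t ^ r` exceeds `N`; below it the constant
dominates. -/
theorem mul_le_rpow_add {t N p r : ℝ} (ht : 0 ≤ t) (hN : 1 ≤ N) (hr : 0 < r) (hp : 1 + r ≤ p) :
    N * t ≤ t ^ p + N * N ^ (1 / r) := by
  rcases le_or_gt t (N ^ (1 / r)) with h | h
  · have : 0 ≤ t ^ p := Real.rpow_nonneg ht p
    have := mul_le_mul_of_nonneg_left h (zero_le_one.trans hN)
    linarith
  · have h1 : 1 ≤ N ^ (1 / r) := Real.one_le_rpow hN (by positivity)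
    have ht1 : 1 ≤ t := h1.trans h.le
    have h2 : N ≤ t ^ r := by
      have := Real.rpow_le_rpow (by positivity) h.le hr.le
      rwa [← Real.rpow_mul (by linarith), one_div_mul_cancel hr.ne', Real.rpow_one] at this
    have h3 : t ^ r * t ≤ t ^ p := by
      rw [← Real.rpow_add_one (by linarith)]
      exact Real.rpow_le_rpow_of_exponent_le ht1 (by linarith)
    have h4 := mul_le_mul_of_nonneg_right h2 ht
    have : 0 ≤ N * N ^ (1 / r) := by positivity
    linarith

section Singular

variable {a b : ℝ} {f : ℝ → ℝ} {p : ℝ → ℝ} (hab : a ≤ b) (hf : BoundedVariationOn f (Icc a b))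

theorem absDs_le_of_one_add_le (hab' : a < b)
    (hleft : ∀ x ∈ Ioc a b, ContinuousWithinAt f (Iic x) x)
    (hp : ContinuousOn p (Icc a b)) {r : ℝ} (hr : 0 < r)
    (hfin : upperVariation (varExp p) a b f < ∞) :
    absDs hab hf {x ∈ Icc a b | 1 + r ≤ p x} = 0 := by
  have := Partition.fine_neBot hab'
  set B := {x ∈ Icc a b | 1 + r ≤ p x}
  have hB : MeasurableSet B :=
    (hp.preimage_isClosed_of_isClosed isClosed_Icc isClosed_Ici (t := Ici (1 + r))).measurableSet
  by_contra h0
  have hε : absDs hab hf B / 2 ≠ 0 := (ENNReal.half_pos h0).ne'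
  have hBtop : absDs hab hf B ≠ ∞ := measure_ne_top _ _
  obtain ⟨K, hKB, hK, hK0, hev⟩ := exists_isCompact_eventually_absDs_le hab hf hleft hB
    (fun x hx => hx.1) hε
  have key : ∀ N : ℝ, 1 ≤ N →
      ENNReal.ofReal N * (absDs hab hf B / 2) ≤ upperVariation (varExp p) a b f + 1 := by
    intro N hN
    set C := N * N ^ (1 / r) with hCdef
    have hC : 0 < C := by positivity
    have hC' : ENNReal.ofReal C ≠ 0 := (ENNReal.ofReal_pos.2 hC).ne'
    rw [upperVariation, ← limsup_add_const _ _ _ (by isBoundedDefault) (by isBoundedDefault)]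
    refine le_limsup_of_frequently_le (Eventually.frequently ?_) (by isBoundedDefault)
    -- Total length at most `1 / C` makes the additive error `C` per unit length cost at most `1`,
    -- uniformly in `N`; then `N → ∞` contradicts finiteness.
    filter_upwards [hev, Partition.eventually_measure_meeting_le volume hK hK0
      (ENNReal.inv_ne_zero.2 (ENNReal.ofReal_ne_top (r := C)))] with P hP hP'
    have h1 : absDs hab hf B / 2 ≤
        ∑ k ∈ P.meeting K, ‖f (P.t k.succ) - f (P.t k.castSucc)‖ₑ := by
      rw [← ENNReal.sub_half hBtop]
      exact tsub_le_iff_right.2 hP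
    have h2 : ∀ k ∈ P.meeting K, ENNReal.ofReal N * ‖f (P.t k.succ) - f (P.t k.castSucc)‖ₑ ≤
        phiPlus (varExp p) (P.interval k) ‖(f (P.t k.succ) - f (P.t k.castSucc)) / P.len k‖₊ *
          ENNReal.ofReal (P.len k) + ENNReal.ofReal C * volume (P.cell k) := by
      intro k hk
      obtain ⟨x, hx, hxK⟩ := Partition.mem_meeting.1 hk
      have hpx : 1 + r ≤ p x := (hKB hxK).2
      rw [← nnnorm_div_mul_ofReal (P.len_pos k), P.volume_cell, ← mul_assoc, ← add_mul]
      refine mul_le_mul' ?_ le_rfl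
      refine le_trans ?_ (add_le_add (le_iSup₂ (f := fun y (_ : y ∈ P.interval k) =>
        varExp p y ‖(f (P.t k.succ) - f (P.t k.castSucc)) / P.len k‖₊) x hx) le_rfl)
      rw [coe_varExp (by linarith), ← enorm_eq_nnnorm, ← ofReal_norm,
        ENNReal.ofReal_rpow_of_nonneg (norm_nonneg _) (by linarith),
        ← ENNReal.ofReal_mul (by linarith), ← ENNReal.ofReal_add (by positivity) hC.le]
      exact ENNReal.ofReal_le_ofReal (mul_le_rpow_add (norm_nonneg _) hN hr hpx)
    calc ENNReal.ofReal N * (absDs hab hf B / 2)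
        ≤ ∑ k ∈ P.meeting K, ENNReal.ofReal N * ‖f (P.t k.succ) - f (P.t k.castSucc)‖ₑ := by
          rw [← Finset.mul_sum]; gcongr
      _ ≤ _ := Finset.sum_le_sum h2
      _ ≤ rieszSum (varExp p) f P + 1 := by
          rw [Finset.sum_add_distrib, ← Finset.mul_sum]
          refine add_le_add (Finset.sum_le_sum_of_subset (Finset.subset_univ _)) ?_
          refine (mul_le_mul' le_rfl hP').trans_eq ?_
          exact ENNReal.mul_inv_cancel hC' ENNReal.ofReal_ne_top
  have hlim : Tendsto (fun N : ℝ => ENNReal.ofReal N * (absDs hab hf B / 2)) atTop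
      (𝓝 (∞ * (absDs hab hf B / 2))) :=
    ENNReal.Tendsto.mul_const ENNReal.tendsto_ofReal_atTop (Or.inl ENNReal.top_ne_zero)
  have h := le_of_tendsto hlim ((eventually_ge_atTop 1).mono key)
  rw [ENNReal.top_mul hε, top_le_iff, ENNReal.add_eq_top] at h
  exact h.elim hfin.ne ENNReal.one_ne_top

theorem absDs_one_lt_eq_zero (hab' : a < b)
    (hleft : ∀ x ∈ Ioc a b, ContinuousWithinAt f (Iic x) x) (hp : ContinuousOn p (Icc a b))
    (hfin : upperVariation (varExp p) a b f < ∞) :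
    absDs hab hf {x ∈ Icc a b | 1 < p x} = 0 := by
  have h : {x ∈ Icc a b | 1 < p x} ⊆ ⋃ n : ℕ, {x ∈ Icc a b | 1 + 1 / ((n : ℝ) + 1) ≤ p x} := by
    rintro x ⟨hx, hpx⟩
    obtain ⟨n, hn⟩ := exists_nat_one_div_lt (sub_pos.2 hpx)
    exact mem_iUnion.2 ⟨n, hx, by linarith⟩
  exact measure_mono_null h (measure_iUnion_null fun n =>
    absDs_le_of_one_add_le hab hf hab' hleft hp Nat.one_div_pos_of_nat hfin)

end Singular

end RieszVar

theorem corollary1p2 {a b : ℝ} (hab : a < b) {f : ℝ → ℝ}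
    (hf : BoundedVariationOn f (Icc a b))
    (hleft : ∀ x ∈ Ioc a b, ContinuousWithinAt f (Iic x) x)
    {Ω : Set ℝ} (hΩ : Icc a b ⊆ Ω) {p : ℝ → ℝ}
    (hp_one : ∀ x ∈ Ω, 1 ≤ p x) (hp_bdd : ∃ M : ℝ, ∀ x ∈ Ω, p x ≤ M)
    (hp_log : RieszVar.StrongLogHolder p Ω) :
    (RieszVar.upperVariation (RieszVar.varExp p) a b f < ∞ →
      RieszVar.absDs hab.le hf {x ∈ Icc a b | 1 < p x} = 0) ∧
    (RieszVar.absDs hab.le hf {x ∈ Icc a b | 1 < p x} = 0 →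
      RieszVar.upperVariation (RieszVar.varExp p) a b f =
        (∫⁻ x in Icc a b, RieszVar.varExp p x ‖RieszVar.density hab.le hf x‖₊) +
          RieszVar.absDs hab.le hf {x ∈ Icc a b | p x = 1}) := by
  have hp := hp_log.continuousOn.mono hΩ
  exact ⟨RieszVar.absDs_one_lt_eq_zero hab.le hf hab hleft hp, fun hs => le_antisymm
    (RieszVar.upperVariation_le hab.le hf hleft hΩ hp_one hp_log hs)
    (RieszVar.le_upperVariation hab.le hf hab hleft (fun x hx => hp_one x (hΩ hx)) hp)⟩
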